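/- Let $n\ge 2$ and let $Q\subset\mathbb R^n$ be a real quadric surface, that is, a nonempty set of the form $$Q=\Big\{x=(\xi_1,\dots,\xi_n)\in\mathbb R^n : \sum_{i,k=1}^n a_{ik}\xi_i\xi_k+2\sum_{i=1}^n b_i\xi_i+c=0\Big\},$$ where $a_{ik}=a_{ki}$, $b_i$, $c$ are real and not all $a_{ik}$ are zero. Then $\mathbb R^n\setminus Q$ has at most four connected components; they are open and their union is $\mathbb R^n\setminus Q$. At least one of these components is convex if and only if there are Cartesian coordinates (orthonormal, with a suitable origin), again denoted $\xi_1,\dots,\xi_n$, in which the equation of $Q$ becomes, after multiplication by a nonzero scalar, one of the equations \begin{align*} & a_1\xi_1^2+\cdots+a_k\xi_k^2=1, && 1\le k\le n,\\ & a_1\xi_1^2-a_2\xi_2^2-\cdots-a_k\xi_k^2=1, && 2\le k\le n,\\ & a_1\xi_1^2=0,\\ & a_1\xi_1^2-a_2\xi_2^2-\cdots-a_k\xi_k^2=0, && 2\le k\le n,\\ & a_1\xi_1^2+\cdots+a_{k-1}\xi_{k-1}^2=\xi_k, && 2\le k\le n, \end{align*} where all scalars $a_i$ involved are positive. -/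

import Mathlib

/-- The left-hand side `∑ a_{ik} ξ_i ξ_k + 2 ∑ b_i ξ_i + c` of a quadratic equation on `ℝⁿ`. -/
def quadricFun {n : ℕ} (A : Matrix (Fin n) (Fin n) ℝ) (b : Fin n → ℝ) (c : ℝ)
    (x : EuclideanSpace ℝ (Fin n)) : ℝ :=
  (∑ i, ∑ k, A i k * x i * x k) + 2 * (∑ i, b i * x i) + c

/-- The locus of real points satisfying the quadratic equation. -/
def quadricSurface {n : ℕ} (A : Matrix (Fin n) (Fin n) ℝ) (b : Fin n → ℝ) (c : ℝ) :
    Set (EuclideanSpace ℝ (Fin n)) :=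
  {x | quadricFun A b c x = 0}

/-- The set of connected components of a subset `S` of a topological space. -/
def componentsOf {X : Type*} [TopologicalSpace X] (S : Set X) : Set (Set X) :=
  {U | ∃ x ∈ S, U = connectedComponentIn S x}

/-- `ListedForm n F` says that `F = 0` is one of the five canonical equations in the coordinates
`ξ_1, …, ξ_n` (here indexed from `0`), all scalars involved being positive. Where the number of
coordinates involved is at least `2`, it is written `k = m + 1` with `1 ≤ m`. -/
inductive ListedForm (n : ℕ) : (EuclideanSpace ℝ (Fin n) → ℝ) → Prop
  /-- `a_1 ξ_1² + ⋯ + a_k ξ_k² = 1`, `1 ≤ k ≤ n` -/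
  | ellipsoid (k : ℕ) (hk1 : 1 ≤ k) (hkn : k ≤ n) (a : Fin k → ℝ) (ha : ∀ i, 0 < a i) :
      ListedForm n fun ξ => (∑ i : Fin k, a i * ξ (Fin.castLE hkn i) ^ 2) - 1
  /-- `a_1 ξ_1² - a_2 ξ_2² - ⋯ - a_k ξ_k² = 1`, `2 ≤ k = m + 1 ≤ n` -/
  | hyperboloid (m : ℕ) (hm : 1 ≤ m) (hmn : m + 1 ≤ n) (a : Fin (m + 1) → ℝ)
      (ha : ∀ i, 0 < a i) :
      ListedForm n fun ξ => a 0 * ξ (Fin.castLE hmn 0) ^ 2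
        - (∑ j : Fin m, a j.succ * ξ (Fin.castLE hmn j.succ) ^ 2) - 1
  /-- `a_1 ξ_1² = 0` -/
  | hyperplane (hn : 0 < n) (a : ℝ) (ha : 0 < a) :
      ListedForm n fun ξ => a * ξ ⟨0, hn⟩ ^ 2
  /-- `a_1 ξ_1² - a_2 ξ_2² - ⋯ - a_k ξ_k² = 0`, `2 ≤ k = m + 1 ≤ n` -/
  | cone (m : ℕ) (hm : 1 ≤ m) (hmn : m + 1 ≤ n) (a : Fin (m + 1) → ℝ)
      (ha : ∀ i, 0 < a i) :
      ListedForm n fun ξ => a 0 * ξ (Fin.castLE hmn 0) ^ 2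
        - ∑ j : Fin m, a j.succ * ξ (Fin.castLE hmn j.succ) ^ 2
  /-- `a_1 ξ_1² + ⋯ + a_{k-1} ξ_{k-1}² = ξ_k`, `2 ≤ k = m + 1 ≤ n` -/
  | paraboloid (m : ℕ) (hm : 1 ≤ m) (hmn : m + 1 ≤ n) (a : Fin m → ℝ) (ha : ∀ i, 0 < a i) :
      ListedForm n fun ξ => (∑ j : Fin m, a j * ξ (Fin.castLE hmn j.castSucc) ^ 2)
        - ξ (Fin.castLE hmn (Fin.last m))

/-- The equation `f = 0` becomes, in suitable Cartesian coordinates `ξ = φ x` (`φ` an affine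
isometry of `ℝⁿ`) and after multiplication by a nonzero scalar, one of the listed equations. -/
def HasListedCanonicalForm {n : ℕ} (f : EuclideanSpace ℝ (Fin n) → ℝ) : Prop :=
  ∃ φ : EuclideanSpace ℝ (Fin n) ≃ᵃⁱ[ℝ] EuclideanSpace ℝ (Fin n),
    ∃ t : ℝ, t ≠ 0 ∧ ∃ F, ListedForm n F ∧ ∀ x, f x = t * F (φ x)

open Set

/-! ### Connected components of the complement of a zero set -/

/-! Diagonalising the symmetric matrix, completing squares and rotating the remaining linear part
reduce the equation to `∑ dᵢ ξᵢ² = e` with `e ∈ {0, 1}`, or to `∑ dᵢ ξᵢ² = ξ_k` with `d_k = 0`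
(`exists_normal_form`). Everything then depends on the signs of the `dᵢ`.

Component count: the set `∑ dᵢ ξᵢ² > e` is empty, two convex sheets, or connected, according as no,
one, or several `dᵢ` are positive. The set `∑ dᵢ ξᵢ² < 1` is star-shaped about the origin, the case
`e = 0` follows by replacing `d` with `-d`, and the sides of a paraboloid are the two sides of a
graph. So each sign of the function contributes at most two pieces.

Convexity: a listed equation has a convex part, either a sublevel set of a convex function or one
sheet, convex by a reversed Cauchy–Schwarz inequality (`convex_sheet`). For an unlisted equation
each side is connected and, if nonempty, contains two points whose midpoint lies outside it. A
convex component would contain both points and the midpoint, hence a zero of the function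
(`not_exists_convex_component`). `central_dichotomy` and `paraboloid_dichotomy` show that these
alternatives are exhaustive. -/

theorem encard_componentsOf_le {X : Type*} [TopologicalSpace X] {S : Set X} {m : ℕ}
    (T : Fin m → Set X) (hT : ∀ i, IsPreconnected (T i)) (hS : ⋃ i, T i = S) :
    (componentsOf S).encard ≤ m := by
  classical
  let g : Fin m → Set X := fun i =>
    if h : (T i).Nonempty then connectedComponentIn S h.some else ∅
  have hsub : componentsOf S ⊆ range g := by
    rintro U ⟨x, hx, rfl⟩
    rw [← hS] at hx
    obtain ⟨i, hi⟩ := mem_iUnion.1 hx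
    have hne : (T i).Nonempty := ⟨x, hi⟩
    refine ⟨i, ?_⟩
    simp only [g, dif_pos hne]
    exact connectedComponentIn_eq ((hT i).subset_connectedComponentIn hne.some_mem
      (hS ▸ subset_iUnion T i) hi)
  calc (componentsOf S).encard ≤ (range g).encard := encard_le_encard hsub
    _ = (g '' univ).encard := by rw [image_univ]
    _ ≤ (univ : Set (Fin m)).encard := encard_image_le _ _
    _ = m := by simp

theorem sUnion_componentsOf {X : Type*} [TopologicalSpace X] (S : Set X) :
    ⋃₀ componentsOf S = S := by
  apply Subset.antisymm
  · rintro x ⟨U, ⟨y, -, rfl⟩, hx⟩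
    exact connectedComponentIn_subset _ _ hx
  · intro x hx
    exact ⟨_, ⟨x, hx, rfl⟩, mem_connectedComponentIn hx⟩

theorem isOpen_of_mem_componentsOf {X : Type*} [TopologicalSpace X] [LocallyConnectedSpace X]
    {S : Set X} (hS : IsOpen S) {U : Set X} (hU : U ∈ componentsOf S) : IsOpen U := by
  obtain ⟨x, -, rfl⟩ := hU
  exact hS.connectedComponentIn

/-- The complement of the zero set of `f` is the disjoint union of two open sets, the first of
which is convex and nonempty. -/
def HasConvexPart {E : Type*} [TopologicalSpace E] [AddCommGroup E] [Module ℝ E]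
    (f : E → ℝ) : Prop :=
  ∃ T T' : Set E, IsOpen T ∧ IsOpen T' ∧ Disjoint T T' ∧ T ∪ T' = {x | f x ≠ 0} ∧
    Convex ℝ T ∧ T.Nonempty

/-- The complement of the zero set of `f` is a union of four preconnected sets. -/
def HasFourPieces {E : Type*} [TopologicalSpace E] (f : E → ℝ) : Prop :=
  ∃ T : Fin 4 → Set E, (∀ i, IsPreconnected (T i)) ∧ ⋃ i, T i = {x | f x ≠ 0}

/-- The positivity set of `f` is preconnected, and if it is nonempty then it is visibly not
convex. -/
def HasNonconvexPositiveSide {E : Type*} [TopologicalSpace E] [AddCommGroup E] [Module ℝ E]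
    (f : E → ℝ) : Prop :=
  IsPreconnected {x | 0 < f x} ∧
    ∀ x, 0 < f x → ∃ u v, 0 < f u ∧ 0 < f v ∧ f (midpoint ℝ u v) ≤ 0

section Components

variable {E : Type*} [NormedAddCommGroup E] [NormedSpace ℝ E]

/-- The convex part is connected and relatively clopen in the complement, so it is itself a
component. -/
theorem HasConvexPart.exists_convex_component {f : E → ℝ} (h : HasConvexPart f) :
    ∃ U ∈ componentsOf {x | f x ≠ 0}, Convex ℝ U := by
  obtain ⟨T, T', hT, hT', hd, hu, hc, x, hx⟩ := h
  have hxS : x ∈ {x | f x ≠ 0} := hu ▸ Or.inl hx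
  refine ⟨T, ⟨x, hxS, ?_⟩, hc⟩
  apply Subset.antisymm
  · exact hc.isPreconnected.subset_connectedComponentIn hx (hu ▸ subset_union_left)
  · exact isPreconnected_connectedComponentIn.subset_left_of_subset_union hT hT' hd
      (hu ▸ connectedComponentIn_subset _ _) ⟨x, mem_connectedComponentIn hxS, hx⟩

/-- The component of `x` contains the whole connected positive side. If it were convex it would
contain a midpoint where `f ≤ 0`, and the intermediate value theorem would give a zero of `f` inside
it. -/
theorem HasNonconvexPositiveSide.not_convex {f : E → ℝ} (hf : Continuous f)
    (h : HasNonconvexPositiveSide f) {x : E} (hx : 0 < f x) :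
    ¬ Convex ℝ (connectedComponentIn {x | f x ≠ 0} x) := by
  intro hc
  obtain ⟨u, v, hu, hv, hm⟩ := h.2 x hx
  have hsub := h.1.subset_connectedComponentIn (F := {x | f x ≠ 0}) hx (fun y hy => ne_of_gt hy)
  have hmem := hc.midpoint_mem (hsub hu) (hsub hv)
  obtain ⟨w, hw, hw0⟩ := hc.isPreconnected.intermediate_value hmem (hsub hu)
    hf.continuousOn ⟨hm, hu.le⟩
  exact connectedComponentIn_subset _ _ hw hw0

theorem not_exists_convex_component {f : E → ℝ} (hf : Continuous f)
    (h : HasNonconvexPositiveSide f) (h' : HasNonconvexPositiveSide (fun x => -f x)) :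
    ¬ ∃ U ∈ componentsOf {x | f x ≠ 0}, Convex ℝ U := by
  rintro ⟨U, ⟨x, hx, rfl⟩, hU⟩
  rcases lt_or_gt_of_ne (show f x ≠ 0 from hx) with hneg | hpos
  · apply h'.not_convex hf.neg (x := x) (by simpa using hneg)
    simpa using hU
  · exact h.not_convex hf hpos hU

variable {F : Type*} [NormedAddCommGroup F] [NormedSpace ℝ F]

theorem HasConvexPart.comp_mul {f : E → ℝ} {g : F → ℝ} (φ : F ≃ᵃⁱ[ℝ] E) {t : ℝ} (ht : t ≠ 0)
    (hg : ∀ x, g x = t * f (φ x)) (h : HasConvexPart f) : HasConvexPart g := by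
  obtain ⟨T, T', hT, hT', hd, hu, hc, x, hx⟩ := h
  refine ⟨φ ⁻¹' T, φ ⁻¹' T', hT.preimage φ.continuous, hT'.preimage φ.continuous,
    hd.preimage φ, ?_, hc.affine_preimage φ.toAffineEquiv.toAffineMap, φ.symm x, by simpa using hx⟩
  rw [← preimage_union, hu]
  ext y
  simp [hg, ht]

theorem HasFourPieces.comp_mul {f : E → ℝ} {g : F → ℝ} (φ : F ≃ᵃⁱ[ℝ] E) {t : ℝ} (ht : t ≠ 0)
    (hg : ∀ x, g x = t * f (φ x)) (h : HasFourPieces f) : HasFourPieces g := by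
  obtain ⟨T, hT, hu⟩ := h
  refine ⟨fun i => φ ⁻¹' T i, fun i => ?_, ?_⟩
  · exact φ.toHomeomorph.isPreconnected_preimage.2 (hT i)
  · rw [← preimage_iUnion, hu]
    ext y
    simp [hg, ht]

theorem HasNonconvexPositiveSide.comp_mul {f : E → ℝ} {g : F → ℝ} (φ : F ≃ᵃⁱ[ℝ] E) {t : ℝ}
    (ht : 0 < t) (hg : ∀ x, g x = t * f (φ x)) (h : HasNonconvexPositiveSide f) :
    HasNonconvexPositiveSide g := by
  refine ⟨?_, fun x hx => ?_⟩
  · have : {x | 0 < g x} = φ ⁻¹' {x | 0 < f x} := by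
      ext y
      simp [hg, ht]
    rw [this]
    exact φ.toHomeomorph.isPreconnected_preimage.2 h.1
  · rw [hg, mul_pos_iff_of_pos_left ht] at hx
    obtain ⟨u, v, hu, hv, hm⟩ := h.2 _ hx
    refine ⟨φ.symm u, φ.symm v, ?_, ?_, ?_⟩
    · simpa [hg, ht] using hu
    · simpa [hg, ht] using hv
    · have hmid : φ (midpoint ℝ (φ.symm u) (φ.symm v)) = midpoint ℝ u v := by
        exact (φ.toAffineEquiv.map_midpoint (φ.symm u) (φ.symm v)).trans (by simp)
      rw [hg, hmid]
      exact mul_nonpos_of_nonneg_of_nonpos ht.le hm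

end Components

/-! ### Connectedness and convexity of the sides of a diagonal quadric -/

section Diagonal

variable {n : ℕ}

local notation "E" => EuclideanSpace ℝ (Fin n)

/-- The convexity defect of each square is exactly `a (1 - a) (xᵢ - yᵢ)²`, up to its nonnegative
weight. -/
theorem convexOn_sum_mul_sq {ι : Type*} [Fintype ι] (g : ι → Fin n) {c : ι → ℝ}
    (hc : ∀ i, 0 ≤ c i) : ConvexOn ℝ univ fun ξ : E => ∑ i, c i * ξ (g i) ^ 2 := by
  refine ⟨convex_univ, fun x _ y _ a b ha hb hab => ?_⟩
  simp only [smul_eq_mul, Finset.mul_sum, ← Finset.sum_add_distrib, PiLp.add_apply,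
    PiLp.smul_apply]
  refine Finset.sum_le_sum fun i _ => ?_
  obtain rfl : b = 1 - a := by linarith
  have : 0 ≤ c i * (a * (1 - a) * (x (g i) - y (g i)) ^ 2) :=
    mul_nonneg (hc i) (mul_nonneg (mul_nonneg ha hb) (sq_nonneg _))
  linear_combination this

/-- The weighted Cauchy–Schwarz inequality for the form `e + ∑ i, c i * x i * y i`. -/
theorem add_sum_mul_sq_le {ι : Type*} [Fintype ι] {c : ι → ℝ} (hc : ∀ i, 0 ≤ c i) {e : ℝ}
    (he : 0 ≤ e) (x y : ι → ℝ) :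
    (e + ∑ i, c i * (x i * y i)) ^ 2 ≤
      (e + ∑ i, c i * x i ^ 2) * (e + ∑ i, c i * y i ^ 2) := by
  have hcs : (∑ i, c i * (x i * y i)) ^ 2 ≤ (∑ i, c i * x i ^ 2) * (∑ i, c i * y i ^ 2) :=
    Finset.sum_sq_le_sum_mul_sum_of_sq_le_mul _ (fun i _ => mul_nonneg (hc i) (sq_nonneg _))
      (fun i _ => mul_nonneg (hc i) (sq_nonneg _)) (fun i _ => by linarith)
  -- AM–GM handles the cross terms with `e` that plain Cauchy–Schwarz leaves over.
  have hag : 2 * ∑ i, c i * (x i * y i) ≤ (∑ i, c i * x i ^ 2) + ∑ i, c i * y i ^ 2 := by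
    rw [Finset.mul_sum, ← Finset.sum_add_distrib]
    refine Finset.sum_le_sum fun i _ => ?_
    have := mul_nonneg (hc i) (sq_nonneg (x i - y i))
    linear_combination this
  linear_combination hcs + e * hag

/-- Put `B(x, y) = d xᵢ yᵢ - ∑ cⱼ xⱼ yⱼ - e`, with `xⱼ`, `yⱼ` read through `g`. Two points with
`B(x, x), B(y, y) > 0` on the same sheet satisfy `B(x, y) > 0` by Cauchy–Schwarz, and on a segment
`B` expands with nonnegative coefficients. The sign of `s` selects the sheet. -/
theorem convex_sheet {ι : Type*} [Fintype ι] (g : ι → Fin n) {c : ι → ℝ} (hc : ∀ i, 0 ≤ c i)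
    {d e : ℝ} (he : 0 ≤ e) (i : Fin n) (s : ℝ) :
    Convex ℝ {ξ : E | 0 < d * ξ i ^ 2 - ∑ j, c j * ξ (g j) ^ 2 - e ∧ 0 < s * ξ i} := by
  rintro x ⟨hx, hxs⟩ y ⟨hy, hys⟩ a b ha hb hab
  have hQ : ∀ z : E, 0 ≤ ∑ j, c j * z (g j) ^ 2 := fun z =>
    Finset.sum_nonneg fun j _ => mul_nonneg (hc j) (sq_nonneg _)
  have hCS := add_sum_mul_sq_le hc he (fun j => x (g j)) (fun j => y (g j))
  have hexp : ∑ j, c j * (a • x + b • y) (g j) ^ 2 =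
      a ^ 2 * (∑ j, c j * x (g j) ^ 2) + b ^ 2 * (∑ j, c j * y (g j) ^ 2) +
        2 * a * b * ∑ j, c j * (x (g j) * y (g j)) := by
    simp only [Finset.mul_sum, ← Finset.sum_add_distrib, PiLp.add_apply, PiLp.smul_apply,
      smul_eq_mul]
    exact Finset.sum_congr rfl fun j _ => by ring
  have hQx := hQ x
  have hQy := hQ y
  simp only [mem_ofPred_eq, hexp]
  generalize (∑ j, c j * x (g j) ^ 2) = p at *
  generalize (∑ j, c j * y (g j) ^ 2) = q at *
  generalize (∑ j, c j * (x (g j) * y (g j))) = r at *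
  simp only [PiLp.add_apply, PiLp.smul_apply, smul_eq_mul]
  generalize x i = u at *
  generalize y i = v at *
  -- No sign of `d` is assumed: for `d ≤ 0` the set is empty.
  have hd : 0 < d := by
    by_contra h
    nlinarith [sq_nonneg u]
  have huv : 0 < u * v := by
    have h := mul_pos hxs hys
    have : 0 < s ^ 2 * (u * v) := by linear_combination h
    exact pos_of_mul_pos_right this (sq_nonneg s)
  have hlt : (e + r) ^ 2 < (d * (u * v)) ^ 2 := by
    have h1 : (e + p) * (e + q) < (d * u ^ 2) * (d * v ^ 2) :=
      mul_lt_mul'' (by linarith) (by linarith) (by linarith) (by linarith)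
    calc (e + r) ^ 2 ≤ (e + p) * (e + q) := hCS
      _ < (d * u ^ 2) * (d * v ^ 2) := h1
      _ = _ := by ring
  have hB : 0 < d * (u * v) - r - e := by
    have := lt_of_pow_lt_pow_left₀ 2 (mul_pos hd huv).le hlt
    linarith
  constructor
  -- The constant is homogenised by `e = e (a + b)²`.
  · have key : d * (a * u + b * v) ^ 2 - (a ^ 2 * p + b ^ 2 * q + 2 * a * b * r) - e =
        a ^ 2 * (d * u ^ 2 - p - e) + b ^ 2 * (d * v ^ 2 - q - e) +
          2 * (a * b) * (d * (u * v) - r - e) := by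
      linear_combination (a + b + 1) * e * hab
    rw [key]
    have h3 := mul_nonneg (mul_nonneg (by norm_num : (0 : ℝ) ≤ 2) (mul_nonneg ha hb)) hB.le
    have h2 := mul_nonneg (sq_nonneg b) hy.le
    rcases ha.eq_or_lt with rfl | ha'
    · obtain rfl : b = 1 := by linarith
      simpa using hy
    · have h1 := mul_pos (pow_pos ha' 2) hx
      linarith
  · rcases ha.eq_or_lt with rfl | ha'
    · obtain rfl : b = 1 := by linarith
      simpa using hys
    · have h1 := mul_pos ha' hxs
      have h2 := mul_nonneg hb hys.le
      linear_combination h1 + h2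

/-- The positive part lives on a subtype, whose cardinality decides connectedness; the negative part
keeps all indices, with weight `0` where `d` is nonnegative. -/
theorem sum_mul_sq_eq_sub (d : Fin n → ℝ) (ξ : Fin n → ℝ) :
    ∑ i, d i * ξ i ^ 2 =
      (∑ i : {i // 0 < d i}, d i * ξ i ^ 2) - ∑ i, max (-d i) 0 * ξ i ^ 2 := by
  have h : ∑ i : {i // 0 < d i}, d i * ξ i ^ 2 = ∑ i, max (d i) 0 * ξ i ^ 2 := by
    refine Fintype.sum_of_injective Subtype.val Subtype.val_injective _ _ (fun i hi => ?_)
      (fun i => by rw [max_eq_left i.2.le])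
    have : ¬ 0 < d i := by simpa using hi
    rw [max_eq_right (not_lt.1 this), zero_mul]
  rw [h, ← Finset.sum_sub_distrib]
  refine Finset.sum_congr rfl fun i _ => ?_
  rw [← sub_mul]
  congr 1
  rcases le_total (d i) 0 with hi | hi
  · rw [max_eq_right hi, max_eq_left (by linarith)]; ring
  · rw [max_eq_left hi, max_eq_right (by linarith)]; ring

/-- The set is a continuous image of `(ℝᵖ ∖ {0}) × E × (0, ∞)`, where `p ≥ 2` makes the punctured
space connected. Here `u` gives the direction in the positive coordinates, `y` the other
coordinates, and `s` the value of the function; `u` is rescaled to attain that value. -/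
theorem isPreconnected_sum_mul_sq_gt {d : Fin n → ℝ} (hP : 1 < Fintype.card {i // 0 < d i})
    {e : ℝ} (he : 0 ≤ e) : IsPreconnected {ξ : E | 0 < ∑ i, d i * ξ i ^ 2 - e} := by
  let Q : ({i // 0 < d i} → ℝ) → ℝ := fun u => ∑ i : {i // 0 < d i}, d i * u i ^ 2
  let N : E → ℝ := fun y => ∑ i, max (-d i) 0 * y i ^ 2
  let Φ : ({i // 0 < d i} → ℝ) × E × ℝ → E := fun z => WithLp.toLp 2 fun i =>
    if h : 0 < d i then z.1 ⟨i, h⟩ * √((e + N z.2.1 + z.2.2) / Q z.1) else z.2.1 i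
  let D : Set (({i // 0 < d i} → ℝ) × E × ℝ) := {0}ᶜ ×ˢ univ ×ˢ Ioi 0
  have hN : ∀ y, 0 ≤ N y := fun y =>
    Finset.sum_nonneg fun i _ => mul_nonneg (le_max_right _ _) (sq_nonneg _)
  have hQ : ∀ u, u ≠ 0 → 0 < Q u := by
    intro u hu
    obtain ⟨i, hi⟩ := Function.ne_iff.1 hu
    exact Finset.sum_pos' (fun i _ => mul_nonneg i.2.le (sq_nonneg _))
      ⟨i, Finset.mem_univ _, mul_pos i.2 (sq_pos_of_ne_zero hi)⟩
  have hD : IsPreconnected D := by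
    refine IsPreconnected.prod ?_ (isPreconnected_univ.prod isPreconnected_Ioi)
    refine (isConnected_compl_singleton_of_one_lt_rank ?_ 0).isPreconnected
    rw [rank_fun']
    exact_mod_cast hP
  have hΦ : ContinuousOn Φ D := by
    refine (PiLp.continuous_toLp 2 _).comp_continuousOn (continuousOn_pi.2 fun i => ?_)
    by_cases h : 0 < d i
    · simp only [h, dif_pos]
      refine ContinuousOn.mul (by fun_prop) (ContinuousOn.sqrt (ContinuousOn.div ?_ ?_ ?_))
      · fun_prop
      · fun_prop
      · exact fun z hz => (hQ _ hz.1).ne'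
    · simp only [h, dif_neg, not_false_eq_true]
      fun_prop
  have himg : Φ '' D = {ξ : E | 0 < ∑ i, d i * ξ i ^ 2 - e} := by
    ext ξ
    constructor
    · rintro ⟨⟨u, y, s⟩, ⟨hu, -, hs⟩, rfl⟩
      have hQu := hQ u hu
      have hs' : 0 < s := hs
      have hnn : 0 ≤ (e + N y + s) / Q u := div_nonneg (by linarith [hN y]) hQu.le
      have h1 : ∑ i : {i // 0 < d i}, d i * Φ (u, y, s) i ^ 2 = e + N y + s := by
        calc _ = ∑ i : {i // 0 < d i}, d i * u i ^ 2 * ((e + N y + s) / Q u) := by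
              refine Finset.sum_congr rfl fun i _ => ?_
              simp only [Φ, i.2, dif_pos, mul_pow, Real.sq_sqrt hnn]
              ring
          _ = Q u * ((e + N y + s) / Q u) := by rw [← Finset.sum_mul]
          _ = _ := by field_simp
      have h2 : ∑ i, max (-d i) 0 * Φ (u, y, s) i ^ 2 = N y := by
        refine Finset.sum_congr rfl fun i _ => ?_
        by_cases h : 0 < d i
        · rw [max_eq_right (by linarith)]; simp
        · simp only [Φ, h, dif_neg, not_false_eq_true]
      change 0 < ∑ i, d i * Φ (u, y, s) i ^ 2 - e
      rw [sum_mul_sq_eq_sub, h1, h2]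
      linarith
    · intro hξ
      have hξ' : 0 < ∑ i, d i * ξ i ^ 2 - e := hξ
      rw [sum_mul_sq_eq_sub] at hξ'
      have hNξ := hN ξ
      have hQpos : 0 < Q fun i => ξ i := by
        change 0 < ∑ i : {i // 0 < d i}, d i * ξ i ^ 2
        change 0 ≤ ∑ i, max (-d i) 0 * ξ i ^ 2 at hNξ
        linarith
      -- With `s` the actual value at `ξ`, the rescaling factor is `1`.
      refine ⟨(fun i => ξ i, ξ, (Q fun i => ξ i) - N ξ - e), ⟨?_, trivial, hξ'⟩, ?_⟩
      · intro h0
        have h0' : (fun i : {i // 0 < d i} => ξ i) = 0 := h0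
        simp [h0', Q] at hQpos
      · ext i
        by_cases h : 0 < d i
        · have : e + N ξ + ((Q fun i => ξ i) - N ξ - e) = Q fun i => ξ i := by ring
          simp only [Φ, h, dif_pos, this, div_self hQpos.ne', Real.sqrt_one, mul_one]
        · simp only [Φ, h, dif_neg, not_false_eq_true]
  rw [← himg]
  exact hD.image _ hΦ

/-- The set is star-shaped about the origin: shrinking by `b ∈ [0, 1]` multiplies the form by `b² ≤
1`, and `e > 0`. -/
theorem isPreconnected_sum_mul_sq_lt (d : Fin n → ℝ) {e : ℝ} (he : 0 < e) :
    IsPreconnected {ξ : E | 0 < -(∑ i, d i * ξ i ^ 2 - e)} := by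
  have hne : (0 : E) ∈ {ξ : E | 0 < -(∑ i, d i * ξ i ^ 2 - e)} := by simpa using he
  refine (StarConvex.isPathConnected (a := (0 : E)) ?_ hne).isConnected.isPreconnected
  intro x hx a b ha hb hab
  have hx' : ∑ i, d i * x i ^ 2 < e := by simpa using hx
  have hsum : ∑ i, d i * (a • (0 : E) + b • x) i ^ 2 = b ^ 2 * ∑ i, d i * x i ^ 2 := by
    rw [Finset.mul_sum]
    exact Finset.sum_congr rfl fun i _ => by simp; ring
  change 0 < -(∑ i, d i * (a • (0 : E) + b • x) i ^ 2 - e)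
  rw [hsum]
  have hb1 : b ^ 2 ≤ 1 := by nlinarith
  rcases le_total (∑ i, d i * x i ^ 2) 0 with h | h
  · nlinarith [sq_nonneg b]
  · nlinarith

theorem sum_mul_sq_update {d : Fin n → ℝ} {k : Fin n} (hk : d k = 0) (y : Fin n → ℝ) (r : ℝ) :
    ∑ i, d i * Function.update y k r i ^ 2 = ∑ i, d i * y i ^ 2 := by
  refine Finset.sum_congr rfl fun i _ => ?_
  by_cases h : i = k
  · subst h; simp [hk]
  · simp [h]

/-- As `d k = 0`, the sum does not involve `ξ k`, so the side is the region above or below a graph,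
parametrised by a base point and a positive height. The condition on `s` encodes `s = ±1`. -/
theorem isPreconnected_paraboloid_side {d : Fin n → ℝ} {k : Fin n} (hk : d k = 0) {s : ℝ}
    (hs : s * s = 1) : IsPreconnected {ξ : E | 0 < s * (∑ i, d i * ξ i ^ 2 - ξ k)} := by
  let Φ : E × ℝ → E := fun z =>
    WithLp.toLp 2 (Function.update z.1 k (∑ i, d i * z.1 i ^ 2 - s * z.2))
  have hΦ : Continuous Φ := by
    refine (PiLp.continuous_toLp 2 _).comp (Continuous.update ?_ k ?_) <;> fun_prop
  have himg : Φ '' (univ ×ˢ Ioi 0) = {ξ : E | 0 < s * (∑ i, d i * ξ i ^ 2 - ξ k)} := by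
    ext ξ
    constructor
    · rintro ⟨⟨y, r⟩, ⟨-, hr⟩, rfl⟩
      have hr' : 0 < r := hr
      simp only [Φ, mem_ofPred_eq, sum_mul_sq_update hk, Function.update_self]
      have : s * (∑ i, d i * y i ^ 2 - (∑ i, d i * y i ^ 2 - s * r)) = r := by
        linear_combination r * hs
      rwa [this]
    · intro hξ
      refine ⟨(ξ, s * (∑ i, d i * ξ i ^ 2 - ξ k)), ⟨trivial, hξ⟩, ?_⟩
      have : ∑ i, d i * ξ i ^ 2 - s * (s * (∑ i, d i * ξ i ^ 2 - ξ k)) = ξ k := by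
        linear_combination -(∑ i, d i * ξ i ^ 2 - ξ k) * hs
      simp only [Φ, this, Function.update_eq_self]
  rw [← himg]
  exact (isPreconnected_univ.prod isPreconnected_Ioi).image _ hΦ.continuousOn

theorem sum_mul_sq_single (d : Fin n → ℝ) (i : Fin n) (a : ℝ) :
    ∑ j, d j * (EuclideanSpace.single i a : E) j ^ 2 = d i * a ^ 2 := by
  rw [Finset.sum_eq_single i] <;> simp +contextual

theorem sum_mul_sq_single_add_single (d : Fin n → ℝ) {i j : Fin n} (hij : i ≠ j) (a b : ℝ) :
    ∑ l, d l * (EuclideanSpace.single i a + EuclideanSpace.single j b : E) l ^ 2 =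
      d i * a ^ 2 + d j * b ^ 2 := by
  rw [← sum_mul_sq_single d i a, ← sum_mul_sq_single d j b, ← Finset.sum_add_distrib]
  refine Finset.sum_congr rfl fun l _ => ?_
  by_cases h : l = i
  · subst h; simp [hij]
  · simp [h]

/-- With no positive coefficient the side is empty. With at least two it is connected and symmetric,
while the midpoint `0` of `x` and `-x` has value `-e ≤ 0`. -/
theorem hasNonconvexPositiveSide_central {d : Fin n → ℝ}
    (hP : Fintype.card {i // 0 < d i} ≠ 1) {e : ℝ} (he : 0 ≤ e) :
    HasNonconvexPositiveSide fun ξ : E => ∑ i, d i * ξ i ^ 2 - e := by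
  rcases Nat.lt_or_gt_of_ne hP with h0 | h2
  · have hd : ∀ i, d i ≤ 0 := by
      intro i
      by_contra h
      have : 0 < Fintype.card {i // 0 < d i} := Fintype.card_pos_iff.2 ⟨⟨i, not_le.1 h⟩⟩
      omega
    have hneg : ∀ ξ : E, ¬ 0 < ∑ i, d i * ξ i ^ 2 - e := by
      intro ξ
      have : ∑ i, d i * ξ i ^ 2 ≤ 0 :=
        Finset.sum_nonpos fun i _ => mul_nonpos_of_nonpos_of_nonneg (hd i) (sq_nonneg _)
      linarith
    refine ⟨?_, fun x hx => absurd hx (hneg x)⟩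
    rw [show {ξ : E | 0 < ∑ i, d i * ξ i ^ 2 - e} = ∅ from eq_empty_of_forall_notMem hneg]
    exact isPreconnected_empty
  · refine ⟨isPreconnected_sum_mul_sq_gt h2 he, fun x hx => ⟨x, -x, hx, by simpa using hx, ?_⟩⟩
    simpa [midpoint_eq_smul_add] using he

theorem hasNonconvexPositiveSide_neg_central {d : Fin n → ℝ} {i j : Fin n} (hi : 0 < d i)
    (hj : d j < 0) : HasNonconvexPositiveSide fun ξ : E => -(∑ i, d i * ξ i ^ 2 - 1) := by
  have hij : i ≠ j := by rintro rfl; linarith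
  refine ⟨isPreconnected_sum_mul_sq_lt d one_pos, fun _ _ => ?_⟩
  have ha : d i * √(1 / d i) ^ 2 = 1 := by
    rw [Real.sq_sqrt (by positivity)]; field_simp
  -- The origin lies in this side, so antipodal points are useless. Instead the midpoint is placed
  -- on the quadric along axis `i`, and moving by `±1` along axis `j` gives the value `-d j > 0`.
  refine ⟨EuclideanSpace.single i √(1 / d i) + EuclideanSpace.single j 1,
    EuclideanSpace.single i √(1 / d i) + EuclideanSpace.single j (-1), ?_, ?_, ?_⟩
  · beta_reduce
    rw [sum_mul_sq_single_add_single d hij, ha]; linarith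
  · beta_reduce
    rw [sum_mul_sq_single_add_single d hij, ha]; linarith
  · have hm : midpoint ℝ (EuclideanSpace.single i √(1 / d i) + EuclideanSpace.single j 1 : E)
        (EuclideanSpace.single i √(1 / d i) + EuclideanSpace.single j (-1)) =
        EuclideanSpace.single i √(1 / d i) := by
      ext l
      simp only [midpoint_eq_smul_add, PiLp.smul_apply, PiLp.add_apply, PiLp.single_apply,
        smul_eq_mul, invOf_eq_inv]
      split_ifs <;> ring
    beta_reduce
    rw [hm, sum_mul_sq_single, ha]; simp

theorem hasNonconvexPositiveSide_paraboloid {d : Fin n → ℝ} {k : Fin n} (hk : d k = 0) {s : ℝ}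
    (hs : s * s = 1) {i : Fin n} (hi : 0 < s * d i) :
    HasNonconvexPositiveSide fun ξ : E => s * (∑ i, d i * ξ i ^ 2 - ξ k) := by
  have hik : k ≠ i := by rintro rfl; simp [hk] at hi
  refine ⟨isPreconnected_paraboloid_side hk hs, fun _ _ =>
    ⟨EuclideanSpace.single i 1, -EuclideanSpace.single i 1, ?_, ?_, ?_⟩⟩
  · beta_reduce
    rw [sum_mul_sq_single]
    simpa [hik] using hi
  · simp only [PiLp.neg_apply, neg_sq]
    rw [sum_mul_sq_single]
    simpa [hik] using hi
  · simp [midpoint_eq_smul_add]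

/-- A single positive coefficient `d i` forces `ξ i ≠ 0` on the set, which splits into two convex
sheets; otherwise one connected piece is used twice. -/
theorem exists_two_pieces_sum_mul_sq_gt (d : Fin n → ℝ) {e : ℝ} (he : 0 ≤ e) :
    ∃ T T' : Set E, IsPreconnected T ∧ IsPreconnected T' ∧
      T ∪ T' = {ξ : E | 0 < ∑ i, d i * ξ i ^ 2 - e} := by
  by_cases hP : Fintype.card {i // 0 < d i} = 1
  · obtain ⟨i, hi⟩ := Fintype.card_eq_one_iff.1 hP
    have hsum : ∀ ξ : E, ∑ j, d j * ξ j ^ 2 =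
        d i * ξ i ^ 2 - ∑ j, max (-d j) 0 * ξ j ^ 2 := by
      intro ξ
      rw [sum_mul_sq_eq_sub, Fintype.sum_eq_single i fun j hj => absurd (hi j) hj]
    have hsheet := convex_sheet (n := n) (id : Fin n → Fin n) (c := fun j => max (-d j) 0)
      (fun _ => le_max_right _ _) (d := d i) he i
    refine ⟨_, _, (hsheet 1).isPreconnected, (hsheet (-1)).isPreconnected, ?_⟩
    ext ξ
    simp only [id, mem_union, mem_ofPred_eq, hsum, ← and_or_left, one_mul, neg_mul,
      Left.neg_pos_iff, and_iff_left_iff_imp]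
    intro h
    refine (lt_or_gt_of_ne (Ne.symm ?_))
    intro h0
    have : 0 ≤ ∑ j, max (-d j) 0 * ξ j ^ 2 :=
      Finset.sum_nonneg fun i _ => mul_nonneg (le_max_right _ _) (sq_nonneg _)
    rw [h0] at h
    norm_num at h
    linarith
  · have := (hasNonconvexPositiveSide_central hP he).1
    exact ⟨_, _, this, this, union_self _⟩

theorem hasFourPieces_of_sides {X : Type*} [TopologicalSpace X] {f : X → ℝ} {T₁ T₂ T₃ T₄ : Set X}
    (h₁ : IsPreconnected T₁) (h₂ : IsPreconnected T₂) (h₃ : IsPreconnected T₃)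
    (h₄ : IsPreconnected T₄) (hpos : T₁ ∪ T₂ = {x | 0 < f x}) (hneg : T₃ ∪ T₄ = {x | 0 < -f x}) :
    HasFourPieces f := by
  refine ⟨![T₁, T₂, T₃, T₄], ?_, ?_⟩
  · intro i
    fin_cases i <;> assumption
  · have : ⋃ i, (![T₁, T₂, T₃, T₄] : Fin 4 → Set X) i = (T₁ ∪ T₂) ∪ (T₃ ∪ T₄) := by
      ext x
      simp [Fin.exists_fin_succ, or_assoc]
    rw [this, hpos, hneg]
    ext x
    simp [or_comm, lt_or_lt_iff_ne]

theorem hasFourPieces_central (d : Fin n → ℝ) {e : ℝ} (he : 0 ≤ e) :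
    HasFourPieces fun ξ : E => ∑ i, d i * ξ i ^ 2 - e := by
  obtain ⟨T₁, T₂, h₁, h₂, hpos⟩ := exists_two_pieces_sum_mul_sq_gt d he
  rcases he.eq_or_lt with rfl | he
  -- For `e = 0` the origin is not in the negative side, which is instead the positive side for
  -- `-d`.
  · obtain ⟨T₃, T₄, h₃, h₄, hneg⟩ := exists_two_pieces_sum_mul_sq_gt (fun i => -d i) le_rfl
    refine hasFourPieces_of_sides h₁ h₂ h₃ h₄ hpos ?_
    rw [hneg]
    simp
  · have h := isPreconnected_sum_mul_sq_lt d he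
    exact hasFourPieces_of_sides h₁ h₂ h h hpos (union_self _)

theorem hasFourPieces_paraboloid {d : Fin n → ℝ} {k : Fin n} (hk : d k = 0) :
    HasFourPieces fun ξ : E => ∑ i, d i * ξ i ^ 2 - ξ k := by
  have h1 := isPreconnected_paraboloid_side hk (s := 1) (by norm_num)
  have h2 := isPreconnected_paraboloid_side hk (s := -1) (by norm_num)
  exact hasFourPieces_of_sides h1 h1 h2 h2 (by simp) (by simp)

end Diagonal

/-! ### The listed equations have a convex component -/

section Listed

variable {n : ℕ}

local notation "E" => EuclideanSpace ℝ (Fin n)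

theorem hasConvexPart_of_convexOn {f : E → ℝ} (hf : Continuous f) (hc : ConvexOn ℝ univ f)
    {x : E} (hx : f x < 0) : HasConvexPart f := by
  refine ⟨{x | f x < 0}, {x | 0 < f x}, isOpen_lt hf continuous_const,
    isOpen_lt continuous_const hf, ?_, ?_, ?_, x, hx⟩
  · exact disjoint_left.2 fun y (hy : f y < 0) (hy' : 0 < f y) => lt_asymm hy hy'
  · ext y
    exact lt_or_lt_iff_ne (a := f y) (b := 0)
  · simpa using hc.convex_lt 0

theorem hasConvexPart_sheet {ι : Type*} [Fintype ι] (g : ι → Fin n) {c : ι → ℝ}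
    (hc : ∀ i, 0 ≤ c i) {d e : ℝ} (hd : 0 < d) (he : 0 ≤ e) {i : Fin n} (hi : ∀ j, g j ≠ i) :
    HasConvexPart fun ξ : E => d * ξ i ^ 2 - ∑ j, c j * ξ (g j) ^ 2 - e := by
  have hf : Continuous fun ξ : E => d * ξ i ^ 2 - ∑ j, c j * ξ (g j) ^ 2 - e := by fun_prop
  have hl : Continuous fun ξ : E => ξ i := by fun_prop
  have hconv := convex_sheet (n := n) g hc (d := d) he i 1
  simp only [one_mul] at hconv
  have hne : ∀ ξ : E, 0 < d * ξ i ^ 2 - ∑ j, c j * ξ (g j) ^ 2 - e → ξ i ≠ 0 := by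
    intro ξ h h0
    have : 0 ≤ ∑ j, c j * ξ (g j) ^ 2 :=
      Finset.sum_nonneg fun j _ => mul_nonneg (hc j) (sq_nonneg _)
    rw [h0] at h
    norm_num at h
    linarith
  refine ⟨{ξ : E | 0 < d * ξ i ^ 2 - ∑ j, c j * ξ (g j) ^ 2 - e ∧ 0 < ξ i},
    {ξ : E | 0 < d * ξ i ^ 2 - ∑ j, c j * ξ (g j) ^ 2 - e ∧ ξ i < 0} ∪
    {ξ : E | d * ξ i ^ 2 - ∑ j, c j * ξ (g j) ^ 2 - e < 0},
    (isOpen_lt continuous_const hf).inter (isOpen_lt continuous_const hl),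
    ((isOpen_lt continuous_const hf).inter (isOpen_lt hl continuous_const)).union
      (isOpen_lt hf continuous_const), ?_, ?_, hconv, ?_⟩
  · refine disjoint_left.2 ?_
    rintro ξ ⟨h1, h2⟩ (⟨-, h3⟩ | h3)
    · exact lt_asymm h2 h3
    · rw [mem_ofPred_eq] at h3
      exact lt_asymm h1 h3
  · ext ξ
    simp only [mem_union, mem_ofPred_eq, ← or_assoc, ← and_or_left]
    constructor
    · rintro (⟨h, -⟩ | h)
      · exact h.ne'
      · exact h.ne
    · intro h
      rcases lt_or_gt_of_ne h with h | h
      · exact Or.inr h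
      · exact Or.inl ⟨h, (lt_or_gt_of_ne (hne ξ h)).symm⟩
  -- On the axis `i` the sum vanishes by `hi`, and this point gives the function the value `1`.
  · refine ⟨EuclideanSpace.single i √((e + 1) / d), ?_, ?_⟩
    · have h0 : ∑ j, c j * (EuclideanSpace.single i √((e + 1) / d) : E) (g j) ^ 2 = 0 :=
        Finset.sum_eq_zero fun j _ => by simp [hi j]
      change 0 < d * (EuclideanSpace.single i √((e + 1) / d) : E) i ^ 2 - _ - e
      rw [h0, PiLp.single_apply, if_pos rfl, Real.sq_sqrt (by positivity)]
      field_simp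
      norm_num
    · simp only [PiLp.single_apply, if_true]
      exact Real.sqrt_pos.2 (by positivity)

theorem ListedForm.hasConvexPart {F : E → ℝ} (h : ListedForm n F) : HasConvexPart F := by
  cases h with
  | ellipsoid k hk1 hkn a ha =>
    refine hasConvexPart_of_convexOn (by fun_prop) ?_ (x := 0) (by simp)
    exact (convexOn_sum_mul_sq (fun i => Fin.castLE hkn i) (fun i => (ha i).le)).sub
      (concaveOn_const 1 convex_univ)
  | hyperboloid m hm hmn a ha =>
    exact hasConvexPart_sheet (fun j : Fin m => Fin.castLE hmn j.succ) (fun j => (ha j.succ).le)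
      (ha 0) zero_le_one fun j => by simp [Fin.ext_iff]
  | hyperplane hn a ha =>
    -- A hyperplane is the degenerate cone with no negative squares; the sheet is an open
    -- half-space.
    have := hasConvexPart_sheet (n := n) (Fin.elim0 : Fin 0 → Fin n) (c := Fin.elim0)
      (fun j => j.elim0) ha le_rfl (i := ⟨0, hn⟩) (fun j => j.elim0)
    simpa using this
  | cone m hm hmn a ha =>
    have := hasConvexPart_sheet (fun j : Fin m => Fin.castLE hmn j.succ)
      (fun j => (ha j.succ).le) (ha 0) le_rfl (i := Fin.castLE hmn 0)
      fun j => by simp [Fin.ext_iff]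
    simpa using this
  | paraboloid m hm hmn a ha =>
    refine hasConvexPart_of_convexOn (by fun_prop) ?_
      (x := EuclideanSpace.single (Fin.castLE hmn (Fin.last m)) 1) ?_
    · refine (convexOn_sum_mul_sq (fun j : Fin m => Fin.castLE hmn j.castSucc)
        (fun j => (ha j).le)).sub ⟨convex_univ, fun x _ y _ s t _ _ _ => ?_⟩
      simp
    · have : ∀ j : Fin m, (j : ℕ) ≠ m := fun j => j.2.ne
      simp [Fin.ext_iff, this]

end Listed

theorem HasListedCanonicalForm.hasConvexPart {n : ℕ} {f : EuclideanSpace ℝ (Fin n) → ℝ}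
    (h : HasListedCanonicalForm f) : HasConvexPart f := by
  obtain ⟨φ, t, ht, F, hF, hf⟩ := h
  exact hF.hasConvexPart.comp_mul φ ht hf

/-! ### Reduction of a quadratic equation to diagonal form -/

section NormalForm

variable {n : ℕ}

local notation "E" => EuclideanSpace ℝ (Fin n)

/-- The new coordinates are those of an orthonormal eigenbasis of `A`; Parseval's identity rewrites
both the quadratic and the linear part. -/
theorem exists_isometry_quadricFun_eq {A : Matrix (Fin n) (Fin n) ℝ} (hA : A.IsSymm)
    (hA0 : A ≠ 0) (b : Fin n → ℝ) (c : ℝ) :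
    ∃ (φ : E ≃ᵃⁱ[ℝ] E) (l β : Fin n → ℝ), l ≠ 0 ∧
      ∀ x, quadricFun A b c x =
        (∑ i, l i * φ x i ^ 2) + 2 * (∑ i, β i * φ x i) + c := by
  have hH : A.IsHermitian := by
    rw [Matrix.IsHermitian, Matrix.conjTranspose_eq_transpose_of_trivial]
    exact hA
  let v := hH.eigenvectorBasis
  refine ⟨v.repr.toAffineIsometryEquiv, hH.eigenvalues,
    fun j => inner ℝ (WithLp.toLp 2 b) (v j), fun h => hA0 (hH.eigenvalues_eq_zero_iff.1 h),
    fun x => ?_⟩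
  have hlin : ∑ i, b i * x i = ∑ j, inner ℝ (WithLp.toLp 2 b) (v j) * inner ℝ (v j) x := by
    rw [v.sum_inner_mul_inner]
    simp [PiLp.inner_apply, mul_comm]
  have hquad : ∑ i, ∑ k, A i k * x i * x k =
      ∑ j, hH.eigenvalues j * inner ℝ (v j) x ^ 2 := by
    have h1 : ∑ i, ∑ k, A i k * x i * x k =
        inner ℝ x (WithLp.toLp 2 (A.mulVec x)) := by
      simp only [PiLp.inner_apply, Matrix.mulVec, dotProduct, RCLike.inner_apply,
        conj_trivial, Finset.sum_mul]
      exact Finset.sum_congr rfl fun i _ => Finset.sum_congr rfl fun k _ => by ring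
    rw [h1, ← v.sum_inner_mul_inner]
    refine Finset.sum_congr rfl fun j _ => ?_
    have h2 : inner ℝ (v j) (WithLp.toLp 2 (A.mulVec x)) =
        hH.eigenvalues j * inner ℝ (v j) x := by
      have h3 : ∀ y z : E, inner ℝ y z = dotProduct (y : Fin n → ℝ) z := fun y z => by
        simp [PiLp.inner_apply, dotProduct, mul_comm]
      rw [h3, h3, Matrix.dotProduct_mulVec, ← Matrix.mulVec_transpose, hA.eq,
        hH.mulVec_eigenvectorBasis, smul_dotProduct]
      simp [v]
    rw [h2, real_inner_comm]
    ring
  simp only [quadricFun, hlin, hquad, LinearIsometryEquiv.coe_toAffineIsometryEquiv,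
    OrthonormalBasis.repr_apply_apply]

/-- Completing the squares. -/
theorem exists_isometry_complete_squares (l β : Fin n → ℝ) (c : ℝ) :
    ∃ (φ : E ≃ᵃⁱ[ℝ] E) (γ : Fin n → ℝ) (c' : ℝ), (∀ i, l i ≠ 0 → γ i = 0) ∧
      ∀ x, (∑ i, l i * x i ^ 2) + 2 * (∑ i, β i * x i) + c =
        (∑ i, l i * φ x i ^ 2) + 2 * (∑ i, γ i * φ x i) + c' := by
  -- Where `l i = 0`, the convention `x / 0 = 0` gives no translation and no change of the constant.
  refine ⟨AffineIsometryEquiv.constVAdd ℝ E (WithLp.toLp 2 fun i => β i / l i),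
    fun i => if l i = 0 then β i else 0, c - ∑ i, β i ^ 2 / l i,
    fun i hi => if_neg hi, fun x => ?_⟩
  have h : ∀ i, l i * x i ^ 2 + 2 * (β i * x i) =
      l i * (β i / l i + x i) ^ 2 + 2 * ((if l i = 0 then β i else 0) * (β i / l i + x i)) -
        β i ^ 2 / l i := by
    intro i
    by_cases hi : l i = 0
    · simp [hi]
    · simp only [hi, if_false]
      field_simp
      ring
  have hs := Finset.sum_congr (rfl : Finset.univ = Finset.univ) fun i _ => h i
  simp only [Finset.sum_sub_distrib, Finset.sum_add_distrib, ← Finset.mul_sum] at hs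
  simp only [AffineIsometryEquiv.coe_constVAdd, vadd_eq_add, PiLp.add_apply]
  linarith

/-- A linear form vanishing in the directions involved in a diagonal quadratic form is, in
suitable orthonormal coordinates not affecting the quadratic form, a multiple of a coordinate. -/
theorem exists_isometry_linear_eq {l γ : Fin n → ℝ} (hγ : ∀ i, l i ≠ 0 → γ i = 0) {k : Fin n}
    (hk : γ k ≠ 0) :
    ∃ (φ : E ≃ₗᵢ[ℝ] E) (r : ℝ), r ≠ 0 ∧ (∀ x, ∀ i, l i ≠ 0 → φ x i = x i) ∧
      ∀ x : E, ∑ i, γ i * x i = r * φ x k := by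
  have hlk : l k = 0 := by
    by_contra h
    exact hk (hγ k h)
  let w : E := WithLp.toLp 2 γ
  have hw : w ≠ 0 := fun h => hk (congrArg (fun z : E => z k) h)
  have hnw : ‖w‖ ≠ 0 := norm_ne_zero_iff.2 hw
  let v : Fin n → E := fun i => if i = k then ‖w‖⁻¹ • w else EuclideanSpace.single i 1
  -- Only these vectors are prescribed. They are orthonormal because `γ` vanishes where `l` does
  -- not, and they extend to an orthonormal basis.
  let s : Set (Fin n) := {i | l i ≠ 0 ∨ i = k}
  have hv : Orthonormal ℝ (s.domRestrict v) := by
    constructor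
    · rintro ⟨i, hi⟩
      by_cases h : i = k
      · simp [v, h, norm_smul, hnw]
      · simp [v, h]
    · rintro ⟨i, hi⟩ ⟨j, hj⟩ hij
      have hij' : i ≠ j := fun h => hij (Subtype.ext h)
      by_cases h : i = k
      · have h' : j ≠ k := fun h' => hij' (h.trans h'.symm)
        have hlj : γ j = 0 := hγ j (hj.resolve_right h')
        simp [v, h, h', inner_smul_left, EuclideanSpace.inner_single_right, w, hlj]
      · have hli : γ i = 0 := hγ i (hi.resolve_right h)
        by_cases h' : j = k
        · simp [v, h, h', inner_smul_right, EuclideanSpace.inner_single_left, w, hli]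
        · simp [v, h, h', EuclideanSpace.inner_single_left, hij']
  obtain ⟨u, hu⟩ := hv.exists_orthonormalBasis_extension_of_card_eq (by simp)
  refine ⟨u.repr, ‖w‖, hnw, fun x i hi => ?_, fun x => ?_⟩
  · have hik : i ≠ k := by rintro rfl; exact hi hlk
    rw [u.repr_apply_apply, hu i (Or.inl hi)]
    simp [v, hik, EuclideanSpace.inner_single_left]
  · rw [u.repr_apply_apply, hu k (Or.inr rfl)]
    simp only [v, if_true, real_inner_smul_left]
    rw [mul_inv_cancel_left₀ hnw]
    simp [PiLp.inner_apply, w, mul_comm]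

/-- Every quadratic equation is, in suitable Cartesian coordinates and up to a nonzero scalar,
the equation of a central quadric or of a paraboloid in diagonal form. -/
theorem exists_normal_form {A : Matrix (Fin n) (Fin n) ℝ} (hA : A.IsSymm) (hA0 : A ≠ 0)
    (b : Fin n → ℝ) (c : ℝ) :
    ∃ (φ : E ≃ᵃⁱ[ℝ] E) (t : ℝ) (d : Fin n → ℝ), t ≠ 0 ∧ d ≠ 0 ∧
      ((∃ e : ℝ, (e = 0 ∨ e = 1) ∧ ∀ x, quadricFun A b c x = t * (∑ i, d i * φ x i ^ 2 - e)) ∨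
        ∃ k, d k = 0 ∧ ∀ x, quadricFun A b c x = t * (∑ i, d i * φ x i ^ 2 - φ x k)) := by
  obtain ⟨φ₁, l, β, hl, h₁⟩ := exists_isometry_quadricFun_eq hA hA0 b c
  obtain ⟨φ₂, γ, c', hγ, h₂⟩ := exists_isometry_complete_squares l β c
  have hdiv : ∀ (t : ℝ) (y : E), t ≠ 0 →
      ∑ i, l i * y i ^ 2 = t * ∑ i, l i / t * y i ^ 2 := by
    intro t y ht
    rw [Finset.mul_sum]
    exact Finset.sum_congr rfl fun i _ => by field_simp
  have hl0 : ∀ t : ℝ, t ≠ 0 → (fun i => l i / t) ≠ 0 := by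
    intro t ht h
    refine hl (funext fun i => ?_)
    have := congrFun h i
    simpa [ht] using this
  by_cases hγ0 : γ = 0
  · by_cases hc' : c' = 0
    · refine ⟨φ₁.trans φ₂, 1, l, one_ne_zero, hl, Or.inl ⟨0, Or.inl rfl, fun x => ?_⟩⟩
      simp [h₁, h₂, hγ0, hc']
    · refine ⟨φ₁.trans φ₂, -c', fun i => l i / -c', neg_ne_zero.2 hc', hl0 _ (neg_ne_zero.2 hc'),
        Or.inl ⟨1, Or.inr rfl, fun x => ?_⟩⟩
      rw [h₁, h₂, mul_sub, ← hdiv _ _ (neg_ne_zero.2 hc')]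
      simp [hγ0]
  · obtain ⟨k, hk⟩ := Function.ne_iff.1 hγ0
    obtain ⟨φ₃, r, hr, hφ₃, h₃⟩ := exists_isometry_linear_eq hγ hk
    have hlk : l k = 0 := by
      by_contra h
      exact hk (hγ k h)
    have ht : -(2 * r) ≠ 0 := by simpa using hr
    -- This translation along axis `k` absorbs the constant term and leaves the form unchanged,
    -- since `l k = 0`.
    let φ₄ := AffineIsometryEquiv.constVAdd ℝ E (EuclideanSpace.single k (c' / (2 * r)))
    have h₄ : ∀ y : E, ∑ i, l i * φ₄ y i ^ 2 = ∑ i, l i * y i ^ 2 := by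
      intro y
      refine Finset.sum_congr rfl fun i _ => ?_
      by_cases h : i = k
      · simp [h, hlk]
      · simp [φ₄, h]
    have h₅ : ∀ y : E, ∑ i, l i * φ₃ y i ^ 2 = ∑ i, l i * y i ^ 2 := by
      intro y
      refine Finset.sum_congr rfl fun i _ => ?_
      by_cases h : l i = 0
      · simp [h]
      · rw [hφ₃ y i h]
    refine ⟨((φ₁.trans φ₂).trans φ₃.toAffineIsometryEquiv).trans φ₄, -(2 * r),
      fun i => l i / -(2 * r), ht, hl0 _ ht, Or.inr ⟨k, by simp [hlk], fun x => ?_⟩⟩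
    rw [h₁, h₂, mul_sub, ← hdiv _ _ ht]
    simp only [AffineIsometryEquiv.coe_trans, Function.comp_apply,
      LinearIsometryEquiv.coe_toAffineIsometryEquiv, h₄, h₅, h₃]
    simp only [φ₄, AffineIsometryEquiv.coe_constVAdd, vadd_eq_add, PiLp.add_apply,
      PiLp.single_apply, if_true]
    field_simp
    ring

end NormalForm

/-! ### Matching the diagonal forms with the listed equations -/

section Matching

variable {n : ℕ}

local notation "E" => EuclideanSpace ℝ (Fin n)

theorem HasListedCanonicalForm.comp_mul {f g : E → ℝ} (φ : E ≃ᵃⁱ[ℝ] E) {t : ℝ} (ht : t ≠ 0)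
    (hg : ∀ x, g x = t * f (φ x)) (h : HasListedCanonicalForm f) : HasListedCanonicalForm g := by
  obtain ⟨ψ, s, hs, F, hF, hf⟩ := h
  exact ⟨φ.trans ψ, t * s, mul_ne_zero ht hs, F, hF, fun x => by simp [hg, hf, mul_assoc]⟩

/-- Renumbering the coordinates brings any prescribed distinct coordinates to the front. -/
theorem exists_isometry_castLE {k : ℕ} (hkn : k ≤ n) {g : Fin k → Fin n}
    (hg : Function.Injective g) :
    ∃ φ : E ≃ᵃⁱ[ℝ] E, ∀ x i, φ x (Fin.castLE hkn i) = x (g i) := by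
  obtain ⟨σ, hσ⟩ := Equiv.Perm.exists_extending_pair (Fin.castLE hkn) g
    (Fin.castLE_injective hkn) hg
  refine ⟨(LinearIsometryEquiv.piLpCongrLeft 2 ℝ ℝ σ.symm).toAffineIsometryEquiv, fun x i => ?_⟩
  simp [LinearIsometryEquiv.piLpCongrLeft_apply, Equiv.piCongrLeft', hσ]

theorem le_of_injective {k : ℕ} {g : Fin k → Fin n} (hg : Function.Injective g) : k ≤ n := by
  simpa using Fintype.card_le_of_injective g hg

theorem sum_mul_sq_eq_of_injective {k : ℕ} {g : Fin k → Fin n} (hg : Function.Injective g)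
    {d : Fin n → ℝ} (hd : ∀ i, d i ≠ 0 → i ∈ range g) (x : Fin n → ℝ) :
    ∑ i, d i * x i ^ 2 = ∑ j, d (g j) * x (g j) ^ 2 := by
  refine (Fintype.sum_of_injective g hg _ _ (fun i hi => ?_) fun _ => rfl).symm
  have : d i = 0 := by
    by_contra h
    exact hi (hd i h)
  simp [this]

theorem exists_enumeration (p : Fin n → Prop) :
    ∃ (m : ℕ) (g : Fin m → Fin n), Function.Injective g ∧ ∀ i, p i ↔ i ∈ range g := by
  classical
  refine ⟨Fintype.card {i // p i}, fun j => (Fintype.equivFin {i // p i}).symm j,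
    Subtype.val_injective.comp (Equiv.injective _), fun i => ⟨fun h => ?_, ?_⟩⟩
  · exact ⟨Fintype.equivFin {i // p i} ⟨i, h⟩, by simp⟩
  · rintro ⟨j, rfl⟩
    exact Subtype.property _

theorem hasListedCanonicalForm_ellipsoid {d : Fin n → ℝ} (hd : ∀ i, 0 ≤ d i) (hd0 : d ≠ 0) :
    HasListedCanonicalForm fun ξ : E => ∑ i, d i * ξ i ^ 2 - 1 := by
  obtain ⟨k, g, hg, hr⟩ := exists_enumeration fun i => d i ≠ 0
  obtain ⟨φ, hφ⟩ := exists_isometry_castLE (le_of_injective hg) hg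
  obtain ⟨i, hi⟩ := Function.ne_iff.1 hd0
  -- The index `j` serves only to show `1 ≤ k`.
  obtain ⟨j, -⟩ := (hr i).1 hi
  refine ⟨φ, 1, one_ne_zero, _, ListedForm.ellipsoid k j.pos (le_of_injective hg)
    (fun j => d (g j)) (fun j => (hd _).lt_of_ne' ((hr _).2 ⟨j, rfl⟩)), fun x => ?_⟩
  simp [sum_mul_sq_eq_of_injective hg (fun i => (hr i).1), hφ]

theorem hasListedCanonicalForm_sheets {d : Fin n → ℝ} (hP : Fintype.card {i // 0 < d i} = 1)
    {j : Fin n} (hj : d j < 0) {e : ℝ} (he : e = 0 ∨ e = 1) :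
    HasListedCanonicalForm fun ξ : E => ∑ i, d i * ξ i ^ 2 - e := by
  obtain ⟨⟨i, hi⟩, hi'⟩ := Fintype.card_eq_one_iff.1 hP
  have huniq : ∀ l, 0 < d l → l = i := fun l hl => congrArg Subtype.val (hi' ⟨l, hl⟩)
  obtain ⟨m, g, hg, hr⟩ := exists_enumeration fun i => d i < 0
  obtain ⟨j', -⟩ := (hr j).1 hj
  have hg' : Function.Injective (Fin.cons i g : Fin (m + 1) → Fin n) := by
    refine Fin.cons_injective_iff.2 ⟨fun h => ?_, hg⟩
    exact lt_asymm hi ((hr i).2 h)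
  have hsupp : ∀ l, d l ≠ 0 → l ∈ range (Fin.cons i g : Fin (m + 1) → Fin n) := by
    intro l hl
    rw [Fin.range_cons]
    rcases lt_or_gt_of_ne hl with h | h
    · exact Or.inr ((hr l).1 h)
    · exact Or.inl (huniq l h)
  obtain ⟨φ, hφ⟩ := exists_isometry_castLE (le_of_injective hg') hg'
  have ha : ∀ l, 0 < (Fin.cons (d i) fun j => -d (g j) : Fin (m + 1) → ℝ) l := by
    intro l
    refine Fin.cases hi (fun j => ?_) l
    exact neg_pos.2 ((hr _).2 ⟨j, rfl⟩)
  rcases he with rfl | rfl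
  · refine ⟨φ, 1, one_ne_zero, _, ListedForm.cone m j'.pos (le_of_injective hg') _ ha,
      fun x => ?_⟩
    simp only [hφ]
    rw [sum_mul_sq_eq_of_injective hg' hsupp, Fin.sum_univ_succ]
    simp
  · refine ⟨φ, 1, one_ne_zero, _, ListedForm.hyperboloid m j'.pos (le_of_injective hg') _ ha,
      fun x => ?_⟩
    simp only [hφ]
    rw [sum_mul_sq_eq_of_injective hg' hsupp, Fin.sum_univ_succ]
    simp

theorem hasListedCanonicalForm_hyperplane {d : Fin n → ℝ}
    (hP : Fintype.card {i // 0 < d i} = 1) (hd : ∀ i, 0 ≤ d i) :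
    HasListedCanonicalForm fun ξ : E => ∑ i, d i * ξ i ^ 2 - 0 := by
  obtain ⟨⟨i, hi⟩, hi'⟩ := Fintype.card_eq_one_iff.1 hP
  have hg : Function.Injective fun _ : Fin 1 => i := Function.injective_of_subsingleton _
  obtain ⟨φ, hφ⟩ := exists_isometry_castLE (le_of_injective hg) hg
  refine ⟨φ, 1, one_ne_zero, _, ListedForm.hyperplane i.pos (d i) hi, fun x => ?_⟩
  have h0 : φ x ⟨0, i.pos⟩ = x i := hφ x 0
  beta_reduce
  rw [h0, sum_mul_sq_eq_of_injective hg]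
  · simp
  · intro l hl
    exact ⟨0, (congrArg Subtype.val (hi' ⟨l, (hd l).lt_of_ne' hl⟩)).symm⟩

theorem hasListedCanonicalForm_central_zero {d : Fin n → ℝ}
    (hP : Fintype.card {i // 0 < d i} = 1) :
    HasListedCanonicalForm fun ξ : E => ∑ i, d i * ξ i ^ 2 - 0 := by
  by_cases hd : ∀ i, 0 ≤ d i
  · exact hasListedCanonicalForm_hyperplane hP hd
  · push Not at hd
    obtain ⟨j, hj⟩ := hd
    exact hasListedCanonicalForm_sheets hP hj (Or.inl rfl)

theorem hasListedCanonicalForm_paraboloid {d : Fin n → ℝ} (hd : ∀ i, 0 ≤ d i) (hd0 : d ≠ 0)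
    {k : Fin n} (hk : d k = 0) :
    HasListedCanonicalForm fun ξ : E => ∑ i, d i * ξ i ^ 2 - ξ k := by
  obtain ⟨m, g, hg, hr⟩ := exists_enumeration fun i => d i ≠ 0
  obtain ⟨i, hi⟩ := Function.ne_iff.1 hd0
  obtain ⟨j, -⟩ := (hr i).1 hi
  have hg' : Function.Injective (Fin.snoc g k : Fin (m + 1) → Fin n) :=
    Fin.snoc_injective_iff.2 ⟨hg, fun h => (hr k).2 h hk⟩
  obtain ⟨φ, hφ⟩ := exists_isometry_castLE (le_of_injective hg') hg'
  refine ⟨φ, 1, one_ne_zero, _, ListedForm.paraboloid m j.pos (le_of_injective hg')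
    (fun j => d (g j)) (fun j => (hd _).lt_of_ne' ((hr _).2 ⟨j, rfl⟩)), fun x => ?_⟩
  simp only [hφ, Fin.snoc_castSucc, Fin.snoc_last, one_mul]
  rw [sum_mul_sq_eq_of_injective hg (fun i => (hr i).1)]

/-- The point reflection `x ↦ -x` reverses only the linear term, so combined with the scalar `-1` it
turns `d` into `-d`. -/
theorem hasListedCanonicalForm_paraboloid_neg {d : Fin n → ℝ} (hd : ∀ i, d i ≤ 0) (hd0 : d ≠ 0)
    {k : Fin n} (hk : d k = 0) :
    HasListedCanonicalForm fun ξ : E => ∑ i, d i * ξ i ^ 2 - ξ k := by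
  have h := hasListedCanonicalForm_paraboloid (d := -d) (by simpa using hd) (by simpa using hd0)
    (k := k) (by simpa using hk)
  refine h.comp_mul (LinearIsometryEquiv.neg ℝ).toAffineIsometryEquiv (t := -1) (by norm_num)
    fun x => ?_
  simp
  ring

/-- A diagonal central equation with real points is listed, unless both of its sides are
preconnected and neither is a nonempty convex set. -/
theorem central_dichotomy {d : Fin n → ℝ} {e : ℝ} (he : e = 0 ∨ e = 1 ∧ ∃ i, 0 < d i) :
    HasListedCanonicalForm (fun ξ : E => ∑ i, d i * ξ i ^ 2 - e) ∨
      HasNonconvexPositiveSide (fun ξ : E => ∑ i, d i * ξ i ^ 2 - e) ∧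
        HasNonconvexPositiveSide (fun ξ : E => -(∑ i, d i * ξ i ^ 2 - e)) := by
  rcases he with rfl | ⟨rfl, i, hi⟩
  · by_cases hP : Fintype.card {i // 0 < d i} = 1
    · exact Or.inl (hasListedCanonicalForm_central_zero hP)
    -- For `e = 0`, `d` and `-d` define the same quadric, so a single negative coefficient is also a
    -- listed case.
    · by_cases hN : Fintype.card {i // 0 < (-d) i} = 1
      · refine Or.inl ((hasListedCanonicalForm_central_zero hN).comp_mul
          (AffineIsometryEquiv.refl ℝ E) (t := -1) (by norm_num) fun x => ?_)
        simp
      · refine Or.inr ⟨hasNonconvexPositiveSide_central hP le_rfl, ?_⟩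
        simpa using hasNonconvexPositiveSide_central hN le_rfl
  · by_cases hd : ∀ i, 0 ≤ d i
    · refine Or.inl (hasListedCanonicalForm_ellipsoid hd ?_)
      rintro rfl
      exact lt_irrefl _ hi
    · push Not at hd
      obtain ⟨j, hj⟩ := hd
      by_cases hP : Fintype.card {i // 0 < d i} = 1
      · exact Or.inl (hasListedCanonicalForm_sheets hP hj (Or.inr rfl))
      · exact Or.inr ⟨hasNonconvexPositiveSide_central hP zero_le_one,
          hasNonconvexPositiveSide_neg_central hi hj⟩

/-- Coefficients of one sign give a listed paraboloid; a positive and a negative one make the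
respective sides nonconvex. -/
theorem paraboloid_dichotomy {d : Fin n → ℝ} (hd0 : d ≠ 0) {k : Fin n} (hk : d k = 0) :
    HasListedCanonicalForm (fun ξ : E => ∑ i, d i * ξ i ^ 2 - ξ k) ∨
      HasNonconvexPositiveSide (fun ξ : E => ∑ i, d i * ξ i ^ 2 - ξ k) ∧
        HasNonconvexPositiveSide (fun ξ : E => -(∑ i, d i * ξ i ^ 2 - ξ k)) := by
  by_cases hp : ∀ i, 0 ≤ d i
  · exact Or.inl (hasListedCanonicalForm_paraboloid hp hd0 hk)
  by_cases hn : ∀ i, d i ≤ 0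
  · exact Or.inl (hasListedCanonicalForm_paraboloid_neg hn hd0 hk)
  push Not at hp hn
  obtain ⟨j, hj⟩ := hp
  obtain ⟨i, hi⟩ := hn
  have h1 := hasNonconvexPositiveSide_paraboloid hk (s := 1) (by norm_num) (i := i) (by simpa)
  have h2 := hasNonconvexPositiveSide_paraboloid hk (s := -1) (by norm_num) (i := j) (by simpa)
  simp only [one_mul] at h1
  simp only [neg_mul, one_mul] at h2
  exact Or.inr ⟨h1, h2⟩

/-- The alternative `listed or with two nonconvex sides` is invariant under changes of Cartesian
coordinates and multiplication by nonzero scalars. -/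
theorem sides_comp_mul {f g : E → ℝ} (φ : E ≃ᵃⁱ[ℝ] E) {t : ℝ} (ht : t ≠ 0)
    (hg : ∀ x, g x = t * f (φ x))
    (h : HasListedCanonicalForm f ∨
      HasNonconvexPositiveSide f ∧ HasNonconvexPositiveSide fun x => -f x) :
    HasListedCanonicalForm g ∨
      HasNonconvexPositiveSide g ∧ HasNonconvexPositiveSide fun x => -g x := by
  rcases h with h | ⟨h1, h2⟩
  · exact Or.inl (h.comp_mul φ ht hg)
  · right
    -- A negative scalar exchanges the two sides.
    rcases lt_or_gt_of_ne ht with ht | ht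
    · exact ⟨h2.comp_mul φ (neg_pos.2 ht) fun x => by simp [hg],
        h1.comp_mul φ (neg_pos.2 ht) fun x => by simp [hg]⟩
    · exact ⟨h1.comp_mul φ ht hg, h2.comp_mul φ ht fun x => by simp [hg]⟩

theorem hasFourPieces_and_dichotomy_quadricFun {A : Matrix (Fin n) (Fin n) ℝ} (hA : A.IsSymm)
    (hA0 : A ≠ 0) {b : Fin n → ℝ} {c : ℝ} (hQ : (quadricSurface A b c).Nonempty) :
    HasFourPieces (quadricFun A b c) ∧ (HasListedCanonicalForm (quadricFun A b c) ∨
      HasNonconvexPositiveSide (quadricFun A b c) ∧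
        HasNonconvexPositiveSide fun x => -quadricFun A b c x) := by
  obtain ⟨φ, t, d, ht, hd, ⟨e, he, hf⟩ | ⟨k, hk, hf⟩⟩ := exists_normal_form hA hA0 b c
  · have he' : e = 0 ∨ e = 1 ∧ ∃ i, 0 < d i := by
      refine he.imp_right fun h => ⟨h, ?_⟩
      -- With all `d i ≤ 0` the form never takes the value `1`, contradicting that the quadric has a
      -- point.
      by_contra! hneg
      obtain ⟨x, hx⟩ := hQ
      have hx0 : t * (∑ i, d i * φ x i ^ 2 - e) = 0 := (hf x).symm.trans hx
      have hx1 := (mul_eq_zero.1 hx0).resolve_left ht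
      have : ∑ i, d i * φ x i ^ 2 ≤ 0 :=
        Finset.sum_nonpos fun i _ => mul_nonpos_of_nonpos_of_nonneg (hneg i) (sq_nonneg _)
      linarith
    have he0 : 0 ≤ e := by rcases he with rfl | rfl <;> norm_num
    exact ⟨(hasFourPieces_central d he0).comp_mul φ ht hf,
      sides_comp_mul φ ht hf (central_dichotomy he')⟩
  · exact ⟨(hasFourPieces_paraboloid hk).comp_mul φ ht hf,
      sides_comp_mul φ ht hf (paraboloid_dichotomy hd hk)⟩

theorem continuous_quadricFun (A : Matrix (Fin n) (Fin n) ℝ) (b : Fin n → ℝ) (c : ℝ) :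
    Continuous (quadricFun A b c) := by
  unfold quadricFun
  fun_prop

end Matching

theorem theorem1 {n : ℕ} (hn : 2 ≤ n) (A : Matrix (Fin n) (Fin n) ℝ) (hA : A.IsSymm)
    (hA0 : A ≠ 0) (b : Fin n → ℝ) (c : ℝ) (hQ : (quadricSurface A b c).Nonempty) :
    ((componentsOf (quadricSurface A b c)ᶜ).encard ≤ 4 ∧
      (∀ U ∈ componentsOf (quadricSurface A b c)ᶜ, IsOpen U) ∧
      ⋃₀ componentsOf (quadricSurface A b c)ᶜ = (quadricSurface A b c)ᶜ) ∧
    ((∃ U ∈ componentsOf (quadricSurface A b c)ᶜ, Convex ℝ U) ↔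
      HasListedCanonicalForm (quadricFun A b c)) := by
  have hf := continuous_quadricFun A b c
  have hS : (quadricSurface A b c)ᶜ = {x | quadricFun A b c x ≠ 0} := rfl
  obtain ⟨⟨T, hT, hu⟩, hdich⟩ := hasFourPieces_and_dichotomy_quadricFun hA hA0 hQ
  refine ⟨⟨?_, fun U hU => ?_, sUnion_componentsOf _⟩, fun h => ?_, fun h => ?_⟩
  · exact encard_componentsOf_le T hT hu
  · exact isOpen_of_mem_componentsOf (hS ▸ isOpen_ne_fun hf continuous_const) hU
  · exact hdich.resolve_right fun h' => not_exists_convex_component hf h'.1 h'.2 h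
  · exact h.hasConvexPart.exists_convex_component
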